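/- Let $N\ge 1$ and let $(\Xi,\mathcal T,\mu)$ be a probability space with $\mathcal T$ $\mu$-complete. For every $\xi\in\Xi$ let $A(\xi,\cdot):\mathbb R^N\rightrightarrows\mathbb R^N$ be a maximal monotone operator (a nonempty set-valued operator whose graph is monotone and is maximal for inclusion among monotone subsets of $\mathbb R^N\times\mathbb R^N$), and assume that $\xi\mapsto\operatorname{gr}A(\xi,\cdot)$ is measurable, i.e. $\{\xi:\operatorname{gr}A(\xi,\cdot)\cap H\ne\emptyset\}\in\mathcal T$ for every Borel set $H\subset\mathbb R^N\times\mathbb R^N$. Write $D(\xi)=\{x:A(\xi,x)\neq\emptyset\}$; $A_0(\xi,x)$ for the element of least norm of $A(\xi,x)$, $x\in D(\xi)$; $J_\gamma(\xi,\cdot)=(I+\gamma A(\xi,\cdot))^{-1}$ for the resolvent, $\gamma>0$; $\Pi(\xi,\cdot)$ for the projection onto $\overline{D(\xi)}$; $\mathcal D=\{x: x\in D(\xi)\text{ for }\mu\text{-a.e. }\xi\}$ for the essential intersection of the domains; and $d(\xi,\cdot)$, $\boldsymbol d(\cdot)$ for the distance functions to $D(\xi)$ and to $\mathcal D$. Let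 $$\mathcal A(x)=\int_\Xi A(\xi,x)\,\mu(d\xi)=\Bigl\{\int\varphi\,d\mu\ :\ \varphi:\Xi\to\mathbb R^N\ \mu\text{-integrable},\ \varphi(\xi)\in A(\xi,x)\ \text{for }\mu\text{-a.e. }\xi\Bigr\}$$ be the Aumann integral (this set is empty if $x\notin\mathcal D$). Assume the following. 1. The interior of $\mathcal D$ is not empty, and there exist a closed ball $B\subset\mathcal D$ of positive radius and a $\mu$-integrable function $M:\Xi\to\mathbb R$ such that, for every $x\in B$, $\|A_0(\xi,x)\|\le M(\xi)$ for $\mu$-a.e. $\xi$. 2. For every compact set $K\subset\mathbb R^N$ there exists $\varepsilon>0$ such that $$\sup_{x\in K\cap\mathcal D}\int\|A_0(\xi,x)\|^{1+\varepsilon}\,\mu(d\xi)<\infty,$$ and, moreover, there exists $y_0\in\mathcal D$ such that $\int\|A_0(\xi,y_0)\|^{1+1/\varepsilon}\,\mu(d\xi)<\infty$. 3. There exists $C>0$ such that $\int d(\xi,x)\,\mu(d\xi)\ge C\,\boldsymbol d(x)$ for every $x\in\mathbb R^N$. 4. There exists a function $C:\mathbb R^N\to\mathbb R$, bounded on compact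 sets, such that $\int\|J_\gamma(\xi,x)-\Pi(\xi,x)\|\,\mu(d\xi)\le\gamma\,C(x)$ for every $x\in\mathbb R^N$ and every $\gamma>0$. Then the operator $\mathcal A:\mathbb R^N\rightrightarrows\mathbb R^N$ is maximal monotone. -/

import Mathlib

open MeasureTheory
open scoped ENNReal

noncomputable section

namespace RandMon

variable {E : Type*} [NormedAddCommGroup E] [InnerProductSpace ℝ E]

/-- The graph of a set-valued operator. -/
def graph (A : E → Set E) : Set (E × E) := {p | p.2 ∈ A p.1}

/-- The domain of a set-valued operator. -/
def dom (A : E → Set E) : Set E := {x | (A x).Nonempty}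

/-- Monotonicity of a subset of `E × E`. -/
def IsMonotoneGraph (G : Set (E × E)) : Prop :=
  ∀ p ∈ G, ∀ q ∈ G, 0 ≤ inner ℝ (p.2 - q.2) (p.1 - q.1)

/-- A maximal monotone operator: a nonempty operator whose graph is monotone and is maximal,
for inclusion, among the monotone subsets of `E × E`. -/
def IsMaximalMonotone (A : E → Set E) : Prop :=
  (graph A).Nonempty ∧ Maximal IsMonotoneGraph (graph A)

/-- The set-valued resolvent `(I + γ A)⁻¹`. -/
def resolventSet (γ : ℝ) (A : E → Set E) (x : E) : Set E := {y | ∃ v ∈ A y, y + γ • v = x}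

/-- The value `J_γ(x)` of the resolvent, which is single-valued and everywhere defined when `A` is
maximal monotone, `γ > 0` and `E` is a Hilbert space (arbitrary value elsewhere). -/
def resolvent (γ : ℝ) (A : E → Set E) (x : E) : E :=
  Classical.epsilon fun y => y ∈ resolventSet γ A x

/-- The projection of `x` onto `S`: the point of `S` closest to `x`, which exists and is unique
when `S` is a nonempty closed convex set in a Hilbert space (arbitrary value if there is none). -/
def proj (S : Set E) (x : E) : E :=
  Classical.epsilon fun y => y ∈ S ∧ dist x y = Metric.infDist x S

/-- The element `A₀(x)` of least norm of `A x`, for `x` in the domain of `A`. -/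
def leastNorm (A : E → Set E) (x : E) : E := proj (A x) 0

section Random

variable {Ξ : Type*} [MeasurableSpace Ξ]

/-- Measurability of `ξ ↦ graph (A ξ)` as a set-valued function. -/
def IsMeasurableOperator [MeasurableSpace E] (A : Ξ → E → Set E) : Prop :=
  ∀ H : Set (E × E), MeasurableSet H → MeasurableSet {ξ | (graph (A ξ) ∩ H).Nonempty}

/-- The essential intersection of the domains of the operators `A ξ`. -/
def essDom (μ : Measure Ξ) (A : Ξ → E → Set E) : Set E := {x | ∀ᵐ ξ ∂μ, x ∈ dom (A ξ)}

/-- The Aumann integral: the set of integrals of all integrable a.e. selections. -/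
def aumannIntegral (μ : Measure Ξ) (F : Ξ → Set E) : Set E :=
  {y | ∃ φ : Ξ → E, Integrable φ μ ∧ (∀ᵐ ξ ∂μ, φ ξ ∈ F ξ) ∧ ∫ ξ, φ ξ ∂μ = y}

/-- The mean operator `x ↦ ∫ A(ξ, x) μ(dξ)`. -/
def meanOperator (μ : Measure Ξ) (A : Ξ → E → Set E) (x : E) : Set E :=
  aumannIntegral μ fun ξ => A ξ x

/-- The mean operator is empty off the essential intersection of the domains. -/
theorem dom_meanOperator_subset (μ : Measure Ξ) (A : Ξ → E → Set E) :
    dom (meanOperator μ A) ⊆ essDom μ A := by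
  rintro x ⟨_, φ, -, hφ, -⟩
  filter_upwards [hφ] with ξ hξ
  exact ⟨φ ξ, hξ⟩

end Random

end RandMon

end

/-! Monotonicity passes through the integral, so by the easy half of Minty's theorem it suffices to
solve `x + 𝒜 x ∋ y` for every `y` (`isMaximalMonotone_of_surjective`). Replace `A ξ` by its Yosida
approximation of parameter `γₙ → 0`. The mean is then Lipschitz and monotone, so the regularised
equation has a solution `uₙ`.

Monotonicity tested at the centre of the ball bounds `uₙ`; tested on the whole ball, it bounds the
Yosida terms at `uₙ` in `L¹`. Hence `uₙ` is on average `O(γₙ)` away from the random domains, and by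
linear regularity `O(γₙ)` away from a point `vₙ` of their essential intersection. The Yosida map
being `1/γₙ`-Lipschitz, its values at `uₙ` and `vₙ` differ by a bounded amount, and at `vₙ` it is
dominated by the least-norm selection: this gives a bound in `L^{1+ε}`.

Weak compactness is then used in Mazur's form: convex combinations of tails converge in `L¹`
(`exists_isTailWeight_tendsto_Lp`), and their limit is a selection of `A ξ x` at a limit point `x`
of `uₙ` (`IsMaximalMonotone.mem_of_tendsto_linearCombination_yosida`). Its integral is `y - x`. -/

noncomputable section

namespace RandMon

variable {E : Type*} [NormedAddCommGroup E] [InnerProductSpace ℝ E]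

/-! ### Minty's theorem and criteria for maximality. -/

section Minty

open Set

lemma convexOn_inner_add_sub (a b : E) (s : Set E) (hs : Convex ℝ s) :
    ConvexOn ℝ s fun x => inner ℝ (b + x) (x - a) := by
  refine ⟨hs, fun x _ y _ t u ht hu htu => ?_⟩
  obtain rfl : u = 1 - t := by linarith
  have h : t * inner ℝ (b + x) (x - a) + (1 - t) * inner ℝ (b + y) (y - a)
      - inner ℝ (b + (t • x + (1 - t) • y)) (t • x + (1 - t) • y - a)
      = t * (1 - t) * inner ℝ (x - y) (x - y) := by
    simp only [inner_add_left, inner_sub_right, inner_add_right, inner_sub_left,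
      real_inner_smul_left, real_inner_smul_right]
    rw [real_inner_comm x y]
    ring
  have h2 : 0 ≤ t * (1 - t) * inner ℝ (x - y) (x - y) :=
    mul_nonneg (mul_nonneg ht hu) real_inner_self_nonneg
  simp only [smul_eq_mul]
  linarith

/-- The finite case of the Debrunner–Flor extension lemma. -/
lemma exists_forall_inner_le_zero {ι : Type*} [Fintype ι] [Nonempty ι] (a b : ι → E)
    (hab : ∀ i j, 0 ≤ inner ℝ (b i - b j) (a i - a j)) :
    ∃ x, ∀ j, inner ℝ (b j + x) (x - a j) ≤ 0 := by
  classical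
  let X : Set E := convexHull ℝ (range a)
  let Y : Set (ι → ℝ) := stdSimplex ℝ ι
  let f : E → (ι → ℝ) → ℝ := fun x q => ∑ j, q j * inner ℝ (b j + x) (x - a j)
  have hX : Convex ℝ X := convex_convexHull ℝ _
  obtain ⟨i₀⟩ := ‹Nonempty ι›
  -- At a saddle point `(p, q)`, each `f p eⱼ` is at most `f x q` for every `x` in the hull, so one
  -- `x` with `f x q ≤ 0` is enough.
  obtain ⟨p, -, q, hq, hpq⟩ := Sion.exists_isSaddlePointOn (X := X) (Y := Y) (f := f)
    ⟨a i₀, subset_convexHull ℝ _ ⟨i₀, rfl⟩⟩ hX ((finite_range a).isCompact_convexHull (𝕜 := ℝ))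
    (fun q _ => by
      have : Continuous fun x => f x q := by fun_prop
      exact this.lowerSemicontinuous.lowerSemicontinuousOn _)
    (fun q hq => by
      have : ConvexOn ℝ X fun x => f x q := by
        refine ⟨hX, fun x hx y hy t u ht hu htu => ?_⟩
        simp only [f, smul_eq_mul, Finset.mul_sum]
        rw [← Finset.sum_add_distrib]
        refine Finset.sum_le_sum fun j _ => ?_
        have := (convexOn_inner_add_sub (a j) (b j) X hX).2 hx hy ht hu htu
        simp only [smul_eq_mul] at this
        nlinarith [mul_le_mul_of_nonneg_left this (hq.1 j)]
      exact this.quasiconvexOn)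
    (convex_stdSimplex ℝ ι) ⟨_, single_mem_stdSimplex ℝ i₀⟩ (isCompact_stdSimplex ℝ ι)
    (fun x _ => by
      have : Continuous fun q => f x q := by fun_prop
      exact this.upperSemicontinuous.upperSemicontinuousOn _)
    (fun x _ => by
      have : ConcaveOn ℝ Y fun q => f x q := by
        refine ⟨convex_stdSimplex ℝ ι, fun q _ r _ t u ht hu htu => le_of_eq ?_⟩
        simp only [f, smul_eq_mul, Finset.mul_sum, Pi.add_apply, Pi.smul_apply]
        rw [← Finset.sum_add_distrib]
        exact Finset.sum_congr rfl fun j _ => by ring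
      exact this.quasiconcaveOn)
  -- At the barycentre of weights `q` the terms quadratic in `x` cancel, and symmetrising the rest
  -- in `(i, j)` leaves only monotonicity pairings.
  set x : E := ∑ j, q j • a j with hx
  have hxX : x ∈ X := (convex_convexHull ℝ _).sum_mem (fun j _ => hq.1 j) hq.2
    fun j _ => subset_convexHull ℝ _ ⟨j, rfl⟩
  have hdiag : f x q ≤ 0 := by
    have h1 : ∀ v : E, inner ℝ v x = ∑ i, q i * inner ℝ v (a i) := fun v => by
      simp [hx, inner_sum, real_inner_smul_right]
    have h2 : f x q = ∑ j, ∑ i, q j * q i * inner ℝ (b j) (a i - a j) := by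
      have h3 : ∑ j, q j * inner ℝ x (x - a j) = 0 := by
        simp only [inner_sub_right, mul_sub, Finset.sum_sub_distrib]
        rw [← h1, ← Finset.sum_mul, hq.2]
        ring
      have h4 : ∀ j, inner ℝ (b j) (x - a j) = ∑ i, q i * inner ℝ (b j) (a i - a j) := fun j => by
        simp only [inner_sub_right, mul_sub, Finset.sum_sub_distrib]
        rw [← h1, ← Finset.sum_mul, hq.2, one_mul]
      simp only [f, inner_add_left (b _) x, mul_add, Finset.sum_add_distrib, h3, add_zero, h4,
        Finset.mul_sum, mul_assoc]
    have h5 : f x q + f x q = ∑ j, ∑ i, q j * q i * -inner ℝ (b j - b i) (a j - a i) := by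
      nth_rewrite 2 [h2]
      rw [Finset.sum_comm, h2, ← Finset.sum_add_distrib]
      refine Finset.sum_congr rfl fun j _ => ?_
      rw [← Finset.sum_add_distrib]
      refine Finset.sum_congr rfl fun i _ => ?_
      simp only [inner_sub_left, inner_sub_right]
      ring
    have h6 : f x q + f x q ≤ 0 := by
      rw [h5]
      refine Finset.sum_nonpos fun j _ => Finset.sum_nonpos fun i _ => ?_
      exact mul_nonpos_of_nonneg_of_nonpos (mul_nonneg (hq.1 j) (hq.1 i))
        (neg_nonpos.2 (hab j i))
    linarith
  refine ⟨p, fun j => ?_⟩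
  have := (hpq x hxX _ (single_mem_stdSimplex ℝ j)).trans hdiag
  simpa [f, Pi.single_apply] using this

lemma IsMaximalMonotone.inner_nonneg {A : E → Set E} (hA : IsMaximalMonotone A) {x y v w : E}
    (hv : v ∈ A x) (hw : w ∈ A y) : 0 ≤ inner ℝ (v - w) (x - y) :=
  hA.2.1 (x, v) hv (y, w) hw

lemma IsMaximalMonotone.mem_of_forall {A : E → Set E} (hA : IsMaximalMonotone A) {x w : E}
    (h : ∀ y v, v ∈ A y → 0 ≤ inner ℝ (v - w) (y - x)) : w ∈ A x := by
  have hins : IsMonotoneGraph (insert (x, w) (graph A)) := by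
    rintro p (rfl | hp) q (rfl | hq)
    · simp
    · have := h q.1 q.2 hq
      rw [← inner_neg_neg]
      simpa using this
    · exact h p.1 p.2 hp
    · exact hA.2.1 p hp q hq
  exact hA.2.2 hins (subset_insert _ _) (mem_insert _ _)

lemma IsMaximalMonotone.isClosed_apply {A : E → Set E} (hA : IsMaximalMonotone A) (x : E) :
    IsClosed (A x) := by
  have : A x = ⋂ p ∈ graph A, {w | 0 ≤ inner ℝ (p.2 - w) (p.1 - x)} := by
    ext w
    simp only [mem_iInter, mem_ofPred_eq]
    exact ⟨fun hw p hp => hA.inner_nonneg hp hw,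
      fun h => hA.mem_of_forall fun y v hv => h (y, v) hv⟩
  rw [this]
  exact isClosed_biInter fun p _ => isClosed_le continuous_const (by fun_prop)

lemma IsMaximalMonotone.leastNorm_mem [ProperSpace E] {A : E → Set E} (hA : IsMaximalMonotone A)
    {x : E} (hx : x ∈ dom A) : leastNorm A x ∈ A x := by
  obtain ⟨y, hy, hdist⟩ := (hA.isClosed_apply x).exists_infDist_eq_dist hx 0
  exact (Classical.epsilon_spec (p := fun y => y ∈ A x ∧ dist 0 y = Metric.infDist 0 (A x))
    ⟨y, hy, hdist.symm⟩).1

/-- The theorem of Minty: the resolvents of a maximal monotone operator are everywhere defined. -/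
theorem IsMaximalMonotone.resolventSet_nonempty [ProperSpace E] {A : E → Set E}
    (hA : IsMaximalMonotone A) {γ : ℝ} (hγ : 0 < γ) (z : E) : (resolventSet γ A z).Nonempty := by
  -- `x ∈ S p` says that `(x, γ⁻¹(z - x))` is monotonically related to `p`. A point common to all `S
  -- p` is the resolvent, by maximality; the finite intersection property provides it, since one `S
  -- p₀` is compact.
  let S : graph A → Set E := fun p => {x | inner ℝ (γ • p.1.2 - z + x) (x - p.1.1) ≤ 0}
  have hSclosed : ∀ p, IsClosed (S p) := fun p => isClosed_le (by fun_prop) continuous_const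
  obtain ⟨p₀, hp₀⟩ := hA.1
  have hSsub : S ⟨p₀, hp₀⟩ ⊆ Metric.closedBall p₀.1 ‖γ • p₀.2 - z + p₀.1‖ := by
    intro x hx
    rw [mem_closedBall_iff_norm]
    have hx' : inner ℝ (γ • p₀.2 - z + x) (x - p₀.1) ≤ 0 := hx
    have h1 : inner ℝ (γ • p₀.2 - z + x) (x - p₀.1)
        = inner ℝ (γ • p₀.2 - z + p₀.1) (x - p₀.1) + ‖x - p₀.1‖ ^ 2 := by
      rw [← real_inner_self_eq_norm_sq, ← inner_add_left]
      congr 1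
      abel
    have h2 := neg_le_of_abs_le (abs_real_inner_le_norm (γ • p₀.2 - z + p₀.1) (x - p₀.1))
    by_contra! hlt
    have h3 : 0 < ‖x - p₀.1‖ := (norm_nonneg _).trans_lt hlt
    nlinarith
  have hScompact : IsCompact (S ⟨p₀, hp₀⟩) :=
    (isCompact_closedBall _ _).of_isClosed_subset (hSclosed _) hSsub
  obtain ⟨x, -, hx⟩ := hScompact.inter_iInter_nonempty S hSclosed fun u => by
    classical
    let u' := insert (⟨p₀, hp₀⟩ : graph A) u
    have : Nonempty u' := ⟨⟨_, Finset.mem_insert_self _ _⟩⟩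
    obtain ⟨x, hx⟩ := exists_forall_inner_le_zero (fun i : u' => i.1.1.1)
      (fun i : u' => γ • i.1.1.2 - z) fun i j => by
        have := hA.2.1 _ i.1.2 _ j.1.2
        rw [sub_sub_sub_cancel_right, ← smul_sub, real_inner_smul_left]
        exact mul_nonneg hγ.le this
    refine ⟨x, hx ⟨_, Finset.mem_insert_self _ _⟩, ?_⟩
    simp only [mem_iInter]
    exact fun p hp => hx ⟨p, Finset.mem_insert_of_mem hp⟩
  rw [mem_iInter] at hx
  refine ⟨x, γ⁻¹ • (z - x), hA.mem_of_forall fun y v hv => ?_, ?_⟩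
  · have h1 : inner ℝ (γ • v - z + x) (x - y) ≤ 0 := hx ⟨(y, v), hv⟩
    have h2 : v - γ⁻¹ • (z - x) = γ⁻¹ • (γ • v - z + x) := by
      rw [smul_add, smul_sub, smul_sub, inv_smul_smul₀ hγ.ne']
      abel
    rw [h2, real_inner_smul_left, ← neg_sub x y, inner_neg_right]
    exact mul_nonneg (inv_nonneg.2 hγ.le) (by linarith)
  · rw [smul_inv_smul₀ hγ.ne']
    abel

/-- A pair `p` of a monotone extension has the same sum `x + v` as some pair of the graph; the two
differences are opposite, so monotonicity forces them to vanish. -/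
lemma isMaximalMonotone_of_surjective {A : E → Set E} (hmono : IsMonotoneGraph (graph A))
    (hsurj : ∀ z, ∃ x, ∃ v ∈ A x, x + v = z) : IsMaximalMonotone A := by
  obtain ⟨x₀, v₀, hv₀, -⟩ := hsurj 0
  refine ⟨⟨(x₀, v₀), hv₀⟩, hmono, fun G hG hAG p hp => ?_⟩
  obtain ⟨x, v, hv, hxv⟩ := hsurj (p.1 + p.2)
  have h1 := hG p hp (x, v) (hAG hv)
  have h2 : p.2 - v = -(p.1 - x) := by
    rw [eq_neg_iff_add_eq_zero, sub_add_sub_comm, sub_eq_zero, add_comm v, hxv, add_comm]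
  rw [h2, inner_neg_left, real_inner_self_eq_norm_sq] at h1
  have h3 : p.1 - x = 0 := by
    rw [← norm_eq_zero]
    nlinarith [norm_nonneg (p.1 - x)]
  have h4 : p = (x, v) := by
    rw [h3, neg_zero] at h2
    exact Prod.ext (sub_eq_zero.1 h3) (sub_eq_zero.1 h2)
  rw [h4]
  exact hv

/-- Minty's trick: test `p` against the graph at `p.1 + t • (p.2 - F p.1)` and let `t` decrease to
`0`. -/
lemma isMaximalMonotone_singleton {F : E → E} (hF : Continuous F)
    (hmono : ∀ x y, 0 ≤ inner ℝ (F x - F y) (x - y)) :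
    IsMaximalMonotone fun x => {F x} := by
  refine ⟨⟨(0, F 0), rfl⟩, ?_, fun G hG hAG p hp => ?_⟩
  · rintro ⟨x, v⟩ (hv : v = F x) ⟨y, w⟩ (hw : w = F y)
    rw [hv, hw]
    exact hmono x y
  · have key : ∀ t : ℝ, 0 < t → 0 ≤ inner ℝ (F (p.1 + t • (p.2 - F p.1)) - p.2) (p.2 - F p.1) := by
      intro t ht
      have := hG (p.1 + t • (p.2 - F p.1), F (p.1 + t • (p.2 - F p.1))) (hAG rfl) p hp
      simp only [add_sub_cancel_left, real_inner_smul_right] at this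
      exact nonneg_of_mul_nonneg_right this ht
    have hc : Continuous fun t : ℝ =>
        inner ℝ (F (p.1 + t • (p.2 - F p.1)) - p.2) (p.2 - F p.1) := by fun_prop
    have hlim := (hc.tendsto 0).mono_left (nhdsWithin_le_nhds (s := Ioi 0))
    have h0 := ge_of_tendsto hlim (Filter.eventually_of_mem self_mem_nhdsWithin key)
    simp only [zero_smul, add_zero] at h0
    rw [← neg_sub, inner_neg_left, real_inner_self_eq_norm_sq] at h0
    have h1 : p.2 - F p.1 = 0 := by
      rw [← norm_eq_zero]
      nlinarith [norm_nonneg (p.2 - F p.1)]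
    exact sub_eq_zero.1 h1

end Minty

/-! ### Yosida approximations. -/

section Yosida

/-- The Yosida approximation `(I - J_γ) / γ`. -/
def yosida (γ : ℝ) (A : E → Set E) (x : E) : E := γ⁻¹ • (x - resolvent γ A x)

variable {A : E → Set E} {γ : ℝ}

lemma resolvent_add_smul_yosida (hγ : 0 < γ) (x : E) :
    resolvent γ A x + γ • yosida γ A x = x := by
  rw [yosida, smul_inv_smul₀ hγ.ne']
  abel

lemma IsMaximalMonotone.yosida_mem [ProperSpace E] (hA : IsMaximalMonotone A) (hγ : 0 < γ)
    (x : E) : yosida γ A x ∈ A (resolvent γ A x) := by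
  obtain ⟨v, hv, hvx⟩ : resolvent γ A x ∈ resolventSet γ A x :=
    Classical.epsilon_spec (hA.resolventSet_nonempty hγ x)
  have : yosida γ A x = v := by
    rw [yosida, ← eq_sub_of_add_eq' hvx, inv_smul_smul₀ hγ.ne']
  rwa [this]

lemma IsMaximalMonotone.eq_resolvent [ProperSpace E] (hA : IsMaximalMonotone A) (hγ : 0 < γ)
    {x y : E} (hy : y ∈ resolventSet γ A x) : y = resolvent γ A x := by
  obtain ⟨v, hv, hvx⟩ := hy
  have h1 := hA.inner_nonneg hv (hA.yosida_mem hγ x)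
  have h2 : γ • (v - yosida γ A x) = -(y - resolvent γ A x) := by
    have := hvx.trans (resolvent_add_smul_yosida (A := A) hγ x).symm
    rw [smul_sub, sub_eq_iff_eq_add, eq_sub_of_add_eq' this]
    abel
  have h3 : 0 ≤ inner ℝ (γ • (v - yosida γ A x)) (y - resolvent γ A x) := by
    rw [real_inner_smul_left]
    exact mul_nonneg hγ.le h1
  rw [h2, inner_neg_left, real_inner_self_eq_norm_sq] at h3
  rw [← sub_eq_zero, ← norm_eq_zero]
  nlinarith [norm_nonneg (y - resolvent γ A x)]

/-- Cocoercivity, the source of both the monotonicity and the `1/γ`-Lipschitz bound. -/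
lemma IsMaximalMonotone.mul_norm_yosida_sub_sq_le [ProperSpace E] (hA : IsMaximalMonotone A)
    (hγ : 0 < γ) (x y : E) :
    γ * ‖yosida γ A x - yosida γ A y‖ ^ 2 ≤ inner ℝ (yosida γ A x - yosida γ A y) (x - y) := by
  have h1 := hA.inner_nonneg (hA.yosida_mem hγ x) (hA.yosida_mem hγ y)
  have h2 : x - y = (resolvent γ A x - resolvent γ A y)
      + γ • (yosida γ A x - yosida γ A y) := by
    conv_lhs => rw [← resolvent_add_smul_yosida (A := A) hγ x,
      ← resolvent_add_smul_yosida (A := A) hγ y]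
    rw [smul_sub]
    abel
  rw [h2, inner_add_right, real_inner_smul_right, real_inner_self_eq_norm_sq]
  linarith

lemma IsMaximalMonotone.inner_yosida_nonneg [ProperSpace E] (hA : IsMaximalMonotone A)
    (hγ : 0 < γ) (x y : E) : 0 ≤ inner ℝ (yosida γ A x - yosida γ A y) (x - y) :=
  le_trans (by positivity) (hA.mul_norm_yosida_sub_sq_le hγ x y)

lemma IsMaximalMonotone.norm_yosida_sub_le [ProperSpace E] (hA : IsMaximalMonotone A)
    (hγ : 0 < γ) (x y : E) : ‖yosida γ A x - yosida γ A y‖ ≤ γ⁻¹ * ‖x - y‖ := by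
  have h1 := (hA.mul_norm_yosida_sub_sq_le hγ x y).trans (real_inner_le_norm _ _)
  rw [le_inv_mul_iff₀ hγ]
  rcases (norm_nonneg (yosida γ A x - yosida γ A y)).eq_or_lt with h | h
  · rw [← h]
    simp
  · exact le_of_mul_le_mul_left (by linarith) h

lemma IsMaximalMonotone.norm_yosida_le [ProperSpace E] (hA : IsMaximalMonotone A)
    (hγ : 0 < γ) {x v : E} (hv : v ∈ A x) : ‖yosida γ A x‖ ≤ ‖v‖ := by
  have h1 := hA.inner_nonneg hv (hA.yosida_mem hγ x)
  have h2 : x - resolvent γ A x = γ • yosida γ A x := by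
    rw [yosida, smul_inv_smul₀ hγ.ne']
  rw [h2, real_inner_smul_right] at h1
  have h3 := nonneg_of_mul_nonneg_right h1 hγ
  rw [inner_sub_left, real_inner_self_eq_norm_sq] at h3
  have h4 := real_inner_le_norm v (yosida γ A x)
  by_contra! hlt
  nlinarith [norm_nonneg v]

lemma IsMaximalMonotone.norm_yosida_le_leastNorm [ProperSpace E] (hA : IsMaximalMonotone A)
    (hγ : 0 < γ) {x : E} (hx : x ∈ dom A) : ‖yosida γ A x‖ ≤ ‖leastNorm A x‖ :=
  hA.norm_yosida_le hγ (hA.leastNorm_mem hx)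

lemma IsMaximalMonotone.infDist_dom_le [ProperSpace E] (hA : IsMaximalMonotone A)
    (hγ : 0 < γ) (x : E) : Metric.infDist x (dom A) ≤ γ * ‖yosida γ A x‖ := by
  have h : resolvent γ A x ∈ dom A := ⟨_, hA.yosida_mem hγ x⟩
  refine (Metric.infDist_le_dist_of_mem h).trans_eq ?_
  rw [dist_eq_norm, yosida, norm_smul, norm_inv, Real.norm_of_nonneg hγ.le,
    mul_inv_cancel_left₀ hγ.ne']

end Yosida

/-! ### Strongly convergent convex combinations in Hilbert spaces and in `L¹`. -/

section ConvexCombinations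

open Filter Topology

/-- Finitely supported convex weights, carried by the indices `≥ k`. -/
structure IsTailWeight (k : ℕ) (w : ℕ →₀ ℝ) : Prop where
  nonneg : ∀ n, 0 ≤ w n
  sum_eq_one : ∑ n ∈ w.support, w n = 1
  le_of_mem : ∀ n ∈ w.support, k ≤ n

lemma exists_isTailWeight_of_mem_convexHull {X : Type*} [AddCommGroup X] [Module ℝ X]
    {F : ℕ → X} {k : ℕ} {x : X} (hx : x ∈ convexHull ℝ (F '' Set.Ici k)) :
    ∃ w, IsTailWeight k w ∧ Finsupp.linearCombination ℝ F w = x := by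
  let S : Set (ℕ →₀ ℝ) := (fun n => Finsupp.single n 1) '' Set.Ici k
  have h1 : F '' Set.Ici k = Finsupp.linearCombination ℝ F '' S := by
    rw [Set.image_image]
    simp
  rw [h1, ← LinearMap.image_convexHull] at hx
  obtain ⟨w, hw, rfl⟩ := hx
  refine ⟨w, ?_, rfl⟩
  let total : (ℕ →₀ ℝ) →ₗ[ℝ] ℝ := Finsupp.linearCombination ℝ fun _ => (1 : ℝ)
  let C : Set (ℕ →₀ ℝ) := {w | (∀ n, 0 ≤ w n) ∧ total w = 1 ∧ ∀ n < k, w n = 0}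
  have hC : Convex ℝ C := by
    rintro u ⟨hu1, hu2, hu3⟩ v ⟨hv1, hv2, hv3⟩ a b ha hb hab
    refine ⟨fun n => ?_, ?_, fun n hn => ?_⟩
    · simpa using add_nonneg (mul_nonneg ha (hu1 n)) (mul_nonneg hb (hv1 n))
    · simp [hu2, hv2, hab]
    · simp [hu3 n hn, hv3 n hn]
  have hSC : S ⊆ C := by
    rintro _ ⟨n, hn, rfl⟩
    refine ⟨fun m => ?_, by simp [total], fun m hm => ?_⟩
    · rw [Finsupp.single_apply]
      split_ifs <;> norm_num
    · exact Finsupp.single_eq_of_ne (hm.trans_le hn).ne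
  obtain ⟨h2, h3, h4⟩ := convexHull_min hSC hC hw
  refine ⟨h2, ?_, fun n hn => ?_⟩
  · simpa [total, Finsupp.linearCombination_apply, Finsupp.sum] using h3
  · by_contra! hlt
    exact Finsupp.mem_support_iff.1 hn (h4 n hlt)

/-- In an inner product space, a bounded sequence has a Cauchy sequence of convex combinations of
its tails. -/
lemma exists_isTailWeight_cauchySeq {H : Type*} [NormedAddCommGroup H] [InnerProductSpace ℝ H]
    (F : ℕ → H) {B : ℝ} (hB : ∀ n, ‖F n‖ ≤ B) :
    ∃ w : ℕ → ℕ →₀ ℝ, (∀ k, IsTailWeight k (w k)) ∧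
      CauchySeq fun k => Finsupp.linearCombination ℝ F (w k) := by
  let C : ℕ → Set H := fun k => convexHull ℝ (F '' Set.Ici k)
  have hCanti : ∀ {k l}, k ≤ l → C l ⊆ C k := fun hkl =>
    convexHull_mono (Set.image_mono (Set.Ici_subset_Ici.2 hkl))
  have hFC : ∀ k, F k ∈ C k := fun k =>
    subset_convexHull ℝ _ ⟨k, Set.mem_Ici.2 le_rfl, rfl⟩
  -- The distances from `0` to the hulls of the tails increase to a finite limit, so
  -- almost-minimisers are Cauchy by the parallelogram law.
  let d : ℕ → ℝ := fun k => sInf (norm '' C k)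
  have hbdd : ∀ k, BddBelow (norm '' C k) := fun k =>
    ⟨0, by rintro _ ⟨x, -, rfl⟩; exact norm_nonneg x⟩
  have hd_le : ∀ {k x}, x ∈ C k → d k ≤ ‖x‖ := fun hx => csInf_le (hbdd _) ⟨_, hx, rfl⟩
  have hd0 : ∀ k, 0 ≤ d k := fun k =>
    Real.sInf_nonneg (by rintro _ ⟨x, -, rfl⟩; exact norm_nonneg x)
  have hdmono : Monotone d := fun k l hkl =>
    csInf_le_csInf (hbdd k) ⟨_, _, hFC l, rfl⟩ (Set.image_mono (hCanti hkl))
  have hdB : ∀ k, d k ≤ B := fun k => (hd_le (hFC k)).trans (hB k)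
  obtain ⟨D, hD⟩ : ∃ D, Tendsto d atTop (𝓝 D) :=
    ⟨_, tendsto_atTop_ciSup hdmono ⟨B, by rintro _ ⟨k, rfl⟩; exact hdB k⟩⟩
  have hex : ∀ k : ℕ, ∃ w, IsTailWeight k w ∧ Finsupp.linearCombination ℝ F w ∈ C k ∧
      ‖Finsupp.linearCombination ℝ F w‖ < d k + 1 / ((k : ℝ) + 1) := by
    intro k
    obtain ⟨_, ⟨x, hx, rfl⟩, hlt⟩ := exists_lt_of_csInf_lt (s := norm '' C k)
      ⟨_, _, hFC k, rfl⟩ (lt_add_of_pos_right (d k) (by positivity : 0 < 1 / ((k : ℝ) + 1)))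
    obtain ⟨w, hw, rfl⟩ := exists_isTailWeight_of_mem_convexHull hx
    exact ⟨w, hw, hx, hlt⟩
  choose w hw hwC hwlt using hex
  refine ⟨w, hw, ?_⟩
  set g : ℕ → H := fun k => Finsupp.linearCombination ℝ F (w k) with hg
  have hgD : Tendsto (fun k => ‖g k‖ ^ 2) atTop (𝓝 (D ^ 2)) := by
    refine Tendsto.pow (tendsto_of_tendsto_of_tendsto_of_le_of_le hD
      (h := fun k => d k + 1 / ((k : ℝ) + 1)) ?_ (fun k => hd_le (hwC k))
      fun k => (hwlt k).le) 2
    simpa using hD.add tendsto_one_div_add_atTop_nhds_zero_nat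
  have hpar : ∀ k l, k ≤ l → ‖g k - g l‖ ^ 2 ≤ 2 * ‖g k‖ ^ 2 + 2 * ‖g l‖ ^ 2 - 4 * d k ^ 2 := by
    intro k l hkl
    have h1 := parallelogram_law_with_norm ℝ (g k) (g l)
    have h2 : (1 / 2 : ℝ) • g k + (1 / 2 : ℝ) • g l ∈ C k :=
      convex_convexHull ℝ _ (hwC k) (hCanti hkl (hwC l)) (by norm_num) (by norm_num) (by norm_num)
    have h3 := hd_le h2
    rw [← smul_add, norm_smul, Real.norm_of_nonneg (by norm_num)] at h3
    nlinarith [hd0 k]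
  rw [Metric.cauchySeq_iff']
  intro ε hε
  have hd2 : Tendsto (fun k => d k ^ 2) atTop (𝓝 (D ^ 2)) := hD.pow 2
  have hη : 0 < ε ^ 2 / 16 := by positivity
  obtain ⟨K, hK⟩ := eventually_atTop.1 ((hgD.eventually (Metric.ball_mem_nhds _ hη)).and
    (hd2.eventually (Metric.ball_mem_nhds _ hη)))
  refine ⟨K, fun n hn => ?_⟩
  have h1 := hpar K n hn
  have h2 := (abs_lt.1 (hK K le_rfl).1).2
  have h3 := (abs_lt.1 (hK n hn).1).2
  have h4 := (abs_lt.1 (hK K le_rfl).2).1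
  rw [dist_comm, dist_eq_norm]
  refine lt_of_pow_lt_pow_left₀ 2 hε.le ?_
  linarith

lemma IsTailWeight.norm_linearCombination_sub_le {X : Type*} [NormedAddCommGroup X]
    [NormedSpace ℝ X] {k : ℕ} {w : ℕ →₀ ℝ} (hw : IsTailWeight k w) {F G : ℕ → X} {δ : ℝ}
    (h : ∀ n, k ≤ n → ‖F n - G n‖ ≤ δ) :
    ‖Finsupp.linearCombination ℝ F w - Finsupp.linearCombination ℝ G w‖ ≤ δ := by
  simp only [Finsupp.linearCombination_apply, Finsupp.sum]
  rw [← Finset.sum_sub_distrib]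
  calc ‖∑ n ∈ w.support, (w n • F n - w n • G n)‖
      ≤ ∑ n ∈ w.support, w n * δ := norm_sum_le_of_le _ fun n hn => by
        rw [← smul_sub, norm_smul, Real.norm_of_nonneg (hw.nonneg n)]
        exact mul_le_mul_of_nonneg_left (h n (hw.le_of_mem n hn)) (hw.nonneg n)
    _ = δ := by rw [← Finset.sum_mul, hw.sum_eq_one, one_mul]

/-- If a sequence in a normed space is uniformly approximated by images of bounded sequences of a
Hilbert space, it has a Cauchy sequence of convex combinations of its tails. -/
lemma exists_isTailWeight_cauchySeq_of_approx {X H : Type*} [NormedAddCommGroup X]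
    [NormedSpace ℝ X] [NormedAddCommGroup H] [InnerProductSpace ℝ H] (T : H →L[ℝ] X)
    (F : ℕ → X) (h : ℕ → ℕ → H) (B : ℕ → ℝ) (hB : ∀ m n, ‖h m n‖ ≤ B m)
    (hF : ∀ δ > 0, ∃ m, ∀ n, ‖F n - T (h m n)‖ ≤ δ) :
    ∃ w : ℕ → ℕ →₀ ℝ, (∀ k, IsTailWeight k (w k)) ∧
      CauchySeq fun k => Finsupp.linearCombination ℝ F (w k) := by
  have hB0 : ∀ m, 0 ≤ B m := fun m => (norm_nonneg _).trans (hB m 0)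
  -- These weights pack all approximation levels `m` into one bounded sequence of `ℓ²(H)`, so that a
  -- single `w` serves every level without diagonal extraction.
  let c : ℕ → ℝ := fun m => (1 / 2) ^ m / (1 + B m)
  have hc : ∀ m, 0 < c m := fun m => div_pos (by positivity) (by linarith [hB0 m])
  have hbound : ∀ n m, ‖c m • h m n‖ ^ 2 ≤ ((1 / 4 : ℝ)) ^ m := by
    intro n m
    have h1 : ‖c m • h m n‖ ≤ (1 / 2) ^ m := by
      rw [norm_smul, Real.norm_of_nonneg (hc m).le, div_mul_eq_mul_div,
        div_le_iff₀ (by linarith [hB0 m])]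
      exact mul_le_mul_of_nonneg_left (by linarith [hB m n]) (by positivity)
    calc ‖c m • h m n‖ ^ 2 ≤ ((1 / 2 : ℝ) ^ m) ^ 2 := pow_le_pow_left₀ (norm_nonneg _) h1 2
      _ = (1 / 4) ^ m := by rw [← pow_mul, mul_comm, pow_mul]; norm_num
  have hgeom : Summable fun m : ℕ => (1 / 4 : ℝ) ^ m :=
    summable_geometric_of_lt_one (by norm_num) (by norm_num)
  have hsum : ∀ n, Summable fun m => ‖c m • h m n‖ ^ 2 := fun n =>
    Summable.of_nonneg_of_le (fun m => by positivity) (hbound n) hgeom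
  let Φ : ℕ → lp (fun _ : ℕ => H) 2 := fun n =>
    ⟨fun m => c m • h m n, memℓp_gen (by simpa using hsum n)⟩
  have hΦ : ∀ n, ‖Φ n‖ ≤ 2 := by
    intro n
    refine lp.norm_le_of_tsum_le (by norm_num) (by norm_num) ?_
    have h1 : ∑' m, ‖c m • h m n‖ ^ 2 ≤ ∑' m : ℕ, (1 / 4 : ℝ) ^ m :=
      (hsum n).tsum_le_tsum (hbound n) hgeom
    rw [tsum_geometric_of_lt_one (by norm_num) (by norm_num)] at h1
    have h2 : ∑' m, ‖c m • h m n‖ ^ 2 ≤ 4 := h1.trans (by norm_num)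
    norm_num
    simpa [Φ] using h2
  obtain ⟨w, hw, hcau⟩ := exists_isTailWeight_cauchySeq Φ hΦ
  refine ⟨w, hw, ?_⟩
  have hcauT : ∀ m, CauchySeq fun k =>
      Finsupp.linearCombination ℝ (fun n => T (h m n)) (w k) := by
    intro m
    let L : lp (fun _ : ℕ => H) 2 →L[ℝ] X :=
      (c m)⁻¹ • T.comp (lp.evalCLM ℝ (fun _ : ℕ => H) 2 m)
    have h1 : CauchySeq fun k => L (Finsupp.linearCombination ℝ Φ (w k)) :=
      hcau.map L.uniformContinuous
    have h2 : ∀ n, L (Φ n) = T (h m n) := by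
      intro n
      have : lp.evalCLM ℝ (fun _ : ℕ => H) 2 m (Φ n) = c m • h m n := rfl
      simp [L, this, inv_smul_smul₀ (hc m).ne']
    convert h1 using 2 with k
    rw [Finsupp.linearCombination_apply, Finsupp.linearCombination_apply, map_finsuppSum]
    simp [h2]
  rw [Metric.cauchySeq_iff']
  intro ε hε
  obtain ⟨m, hm⟩ := hF (ε / 4) (by positivity)
  obtain ⟨K, hK⟩ := Metric.cauchySeq_iff'.1 (hcauT m) (ε / 4) (by positivity)
  refine ⟨K, fun n hn => ?_⟩
  have h1 := hK n hn
  have h2 := (hw n).norm_linearCombination_sub_le (F := F) (G := fun n => T (h m n))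
    fun j _ => hm j
  have h3 := (hw K).norm_linearCombination_sub_le (F := F) (G := fun n => T (h m n))
    fun j _ => hm j
  rw [← dist_eq_norm] at h2 h3
  rw [dist_comm] at h3
  have h4 := dist_triangle4 (Finsupp.linearCombination ℝ F (w n))
    (Finsupp.linearCombination ℝ (fun n => T (h m n)) (w n))
    (Finsupp.linearCombination ℝ (fun n => T (h m n)) (w K))
    (Finsupp.linearCombination ℝ F (w K))
  linarith

/-- Where `m < ‖f‖`, one has `‖f‖ ≤ m^{-ε} ‖f‖^{1+ε}`. It makes truncation error in `L¹` uniformly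
small. -/
lemma lintegral_indicator_enorm_le {Ξ E : Type*} [MeasurableSpace Ξ]
    [NormedAddCommGroup E] (μ : Measure Ξ) {ε : ℝ} (hε : 0 < ε) (f : Ξ → E) {m : ℝ≥0∞}
    (hm : m ≠ 0) (hm' : m ≠ ∞) :
    ∫⁻ ξ, ‖{ξ | m < ‖f ξ‖ₑ}.indicator f ξ‖ₑ ∂μ ≤ (m ^ ε)⁻¹ * ∫⁻ ξ, ‖f ξ‖ₑ ^ (1 + ε) ∂μ := by
  have h0 : m ^ ε ≠ 0 := by simp [ENNReal.rpow_eq_zero_iff, hm, hm']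
  have h1 : m ^ ε ≠ ∞ := ENNReal.rpow_ne_top_of_nonneg hε.le hm'
  rw [← lintegral_const_mul' _ _ (ENNReal.inv_ne_top.2 h0)]
  refine lintegral_mono fun ξ => ?_
  by_cases h : m < ‖f ξ‖ₑ
  · rw [Set.indicator_of_mem (show ξ ∈ {ξ | m < ‖f ξ‖ₑ} from h),
      ENNReal.rpow_add_of_nonneg _ _ zero_le_one hε.le, ENNReal.rpow_one, mul_left_comm]
    refine le_mul_of_one_le_right' ?_
    rw [← ENNReal.inv_mul_cancel h0 h1]
    gcongr
  · rw [Set.indicator_of_notMem (show ξ ∉ {ξ | m < ‖f ξ‖ₑ} from h)]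
    simp

variable {Ξ : Type*} [MeasurableSpace Ξ]

/-- The inclusion of `L²` into `L¹` on a probability space. -/
def lpTwoToLpOne (μ : Measure Ξ) [IsProbabilityMeasure μ] : Lp E 2 μ →L[ℝ] Lp E 1 μ :=
  LinearMap.mkContinuous
    { toFun := fun f => ((Lp.memLp f).mono_exponent (one_le_two)).toLp f
      map_add' := fun f g => by
        rw [← MemLp.toLp_add]
        exact MemLp.toLp_congr _ _ (Lp.coeFn_add f g)
      map_smul' := fun a f => by
        rw [RingHom.id_apply, ← MemLp.toLp_const_smul]
        exact MemLp.toLp_congr _ _ (Lp.coeFn_smul a f) } 1 fun f => by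
    rw [one_mul]
    refine (Lp.norm_toLp f ((Lp.memLp f).mono_exponent one_le_two)).trans_le ?_
    rw [Lp.norm_def]
    exact ENNReal.toReal_mono (Lp.eLpNorm_ne_top f)
      (eLpNorm_le_eLpNorm_of_exponent_le one_le_two (Lp.aestronglyMeasurable f))

lemma coeFn_lpTwoToLpOne (μ : Measure Ξ) [IsProbabilityMeasure μ] (f : Lp E 2 μ) :
    lpTwoToLpOne μ f =ᵐ[μ] f :=
  MemLp.coeFn_toLp ((Lp.memLp f).mono_exponent one_le_two)

/-- A sequence bounded in `L^{1+ε}` has a sequence of convex combinations of its tails which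
converges in `L¹`. -/
theorem exists_isTailWeight_tendsto_Lp [CompleteSpace E] (μ : Measure Ξ) [IsProbabilityMeasure μ]
    {ε : ℝ} (hε : 0 < ε) (F : ℕ → Lp E 1 μ) {S : ℝ≥0∞} (hS : S ≠ ∞)
    (hF : ∀ n, ∫⁻ ξ, ‖F n ξ‖ₑ ^ (1 + ε) ∂μ ≤ S) :
    ∃ w : ℕ → ℕ →₀ ℝ, (∀ k, IsTailWeight k (w k)) ∧
      ∃ G, Tendsto (fun k => Finsupp.linearCombination ℝ F (w k)) atTop (𝓝 G) := by
  have hmeas : ∀ n, StronglyMeasurable (F n) := fun n => Lp.stronglyMeasurable (F n)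
  have hset : ∀ m n : ℕ, MeasurableSet {ξ | ‖F n ξ‖ₑ ≤ m} := fun m n =>
    measurableSet_le (hmeas n).enorm measurable_const
  let t : ℕ → ℕ → Ξ → E := fun m n => {ξ | ‖F n ξ‖ₑ ≤ m}.indicator (F n)
  have htbound : ∀ m n ξ, ‖t m n ξ‖ ≤ m := by
    intro m n ξ
    by_cases h : ‖F n ξ‖ₑ ≤ m
    · rw [show t m n ξ = F n ξ from Set.indicator_of_mem (show ξ ∈ {ξ | ‖F n ξ‖ₑ ≤ m} from h) _]
      rw [← ofReal_norm] at h
      simpa using ENNReal.toReal_mono (by simp) h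
    · rw [show t m n ξ = 0 from Set.indicator_of_notMem (show ξ ∉ {ξ | ‖F n ξ‖ₑ ≤ m} from h) _]
      simp
  have htmem : ∀ m n, MemLp (t m n) 2 μ := fun m n =>
    MemLp.of_bound ((hmeas n).indicator (hset m n)).aestronglyMeasurable m
      (Eventually.of_forall (htbound m n))
  obtain ⟨w, hw, hcau⟩ := exists_isTailWeight_cauchySeq_of_approx (lpTwoToLpOne μ) F
    (fun m n => (htmem m n).toLp) (fun m => measureUnivNNReal μ ^ (2 : ℝ≥0∞).toReal⁻¹ * m) (fun m n =>
      Lp.norm_le_of_ae_bound (f := (htmem m n).toLp) (Nat.cast_nonneg m)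
        ((htmem m n).coeFn_toLp.mono fun ξ hξ => by rw [hξ]; exact htbound m n ξ)) (fun δ hδ => by
      have hlim : Tendsto (fun m : ℕ => (((m : ℝ≥0∞) + 1) ^ ε)⁻¹ * S) atTop (𝓝 0) := by
        have h1 : Tendsto (fun m : ℕ => ((m : ℝ≥0∞) + 1) ^ ε) atTop (𝓝 ∞) := by
          have := (ENNReal.tendsto_rpow_at_top hε).comp
            ((tendsto_add_atTop_iff_nat 1).2 ENNReal.tendsto_nat_nhds_top)
          simpa [Function.comp_def] using this
        have h2 := ENNReal.Tendsto.mul_const (b := S) (tendsto_inv_iff.2 h1) (Or.inr hS)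
        simpa using h2
      obtain ⟨m, hm⟩ := (hlim.eventually_lt_const (ENNReal.ofReal_pos.2 hδ)).exists
      -- Level `m + 1`, because the tail estimate needs a nonzero level.
      refine ⟨m + 1, fun n => ?_⟩
      have hae : (F n - lpTwoToLpOne μ (htmem (m + 1) n).toLp : Lp E 1 μ) =ᵐ[μ]
          {ξ | (m : ℝ≥0∞) + 1 < ‖F n ξ‖ₑ}.indicator (F n) := by
        filter_upwards [Lp.coeFn_sub (F n) (lpTwoToLpOne μ (htmem (m + 1) n).toLp),
          coeFn_lpTwoToLpOne μ (htmem (m + 1) n).toLp, (htmem (m + 1) n).coeFn_toLp]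
          with ξ h1 h2 h3
        rw [h1, Pi.sub_apply, h2, h3]
        by_cases h : (m : ℝ≥0∞) + 1 < ‖F n ξ‖ₑ
        · simp [t, Set.indicator, h, not_le.2 h]
        · simp [t, Set.indicator, h, not_lt.1 h]
      rw [Lp.norm_def, eLpNorm_congr_ae hae, eLpNorm_one_eq_lintegral_enorm]
      refine ENNReal.toReal_le_of_le_ofReal hδ.le ?_
      refine (lintegral_indicator_enorm_le μ hε (F n) (by simp) (by simp)).trans
        (le_trans ?_ hm.le)
      gcongr
      exact hF n)
  exact ⟨w, hw, cauchySeq_tendsto_of_complete hcau⟩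

end ConvexCombinations

/-! ### Closure of the graph under averaged limits. -/

section Limit

open Filter Topology

lemma IsTailWeight.linearCombination_const {X : Type*} [AddCommGroup X] [Module ℝ X] {k : ℕ}
    {w : ℕ →₀ ℝ} (hw : IsTailWeight k w) (c : X) :
    Finsupp.linearCombination ℝ (fun _ => c) w = c := by
  rw [Finsupp.linearCombination_apply, Finsupp.sum, ← Finset.sum_smul, hw.sum_eq_one, one_smul]

lemma tendsto_linearCombination_of_tendsto {X : Type*} [NormedAddCommGroup X] [NormedSpace ℝ X]
    {f : ℕ → X} {a : X} (hf : Tendsto f atTop (𝓝 a)) {w : ℕ → ℕ →₀ ℝ}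
    (hw : ∀ k, IsTailWeight k (w k)) :
    Tendsto (fun k => Finsupp.linearCombination ℝ f (w k)) atTop (𝓝 a) := by
  rw [Metric.tendsto_atTop]
  intro ε hε
  obtain ⟨K, hK⟩ := Metric.tendsto_atTop.1 hf (ε / 2) (by positivity)
  refine ⟨K, fun k hk => ?_⟩
  have := (hw k).norm_linearCombination_sub_le (F := f) (G := fun _ => a) (δ := ε / 2)
    fun n hn => by
      rw [← dist_eq_norm]
      exact (hK n (hk.trans hn)).le
  rw [(hw k).linearCombination_const, ← dist_eq_norm] at this
  linarith

/-- A limit of convex combinations of the tails of a sequence of Yosida approximations at points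
converging to `x` is an element of `A x`. -/
lemma IsMaximalMonotone.mem_of_tendsto_linearCombination_yosida [ProperSpace E] {A : E → Set E}
    (hA : IsMaximalMonotone A) {γ : ℕ → ℝ} (hγ : ∀ n, 0 < γ n) (hγ0 : Tendsto γ atTop (𝓝 0))
    {u : ℕ → E} {x g : E} (hu : Tendsto u atTop (𝓝 x))
    (hsmall : Tendsto (fun n => (‖u n - x‖ + √(γ n)) * ‖yosida (γ n) A (u n)‖) atTop (𝓝 0))
    {w : ℕ → ℕ →₀ ℝ} {κ : ℕ → ℕ} (hκ : Tendsto κ atTop atTop)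
    (hw : ∀ k, IsTailWeight (κ k) (w k))
    (hg : Tendsto (fun k => Finsupp.linearCombination ℝ (fun n => yosida (γ n) A (u n)) (w k))
      atTop (𝓝 g)) : g ∈ A x := by
  refine hA.mem_of_forall fun a v hv => ?_
  set f : ℕ → E := fun n => yosida (γ n) A (u n) with hf
  let c : ℕ → ℝ := fun n => ‖u n - x‖ + √(γ n)
  -- `η n` bounds the cost of replacing the resolvent by `x` in the monotonicity inequality. Writing
  -- `γ‖f‖²` as `(√γ‖f‖)²` is why `√γ` enters `hsmall`; `f n` itself may be unbounded.
  let η : ℕ → ℝ := fun n => ‖v‖ * (c n + √(γ n) * (c n * ‖f n‖)) + (c n * ‖f n‖ + (c n * ‖f n‖) ^ 2)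
  have hsqrt : Tendsto (fun n => √(γ n)) atTop (𝓝 0) := by simpa using hγ0.sqrt
  have hc : Tendsto c atTop (𝓝 0) := by
    have := (tendsto_iff_norm_sub_tendsto_zero.1 hu).add hsqrt
    simpa using this
  have hη : Tendsto η atTop (𝓝 0) := by
    have := ((hc.add (hsqrt.mul hsmall)).const_mul ‖v‖).add (hsmall.add (hsmall.pow 2))
    simpa using this
  have hinner : ∀ n, -η n ≤ inner ℝ (v - f n) (a - x) := by
    intro n
    have h1 := hA.inner_nonneg hv (hA.yosida_mem (hγ n) (u n))
    have h2 : a - resolvent (γ n) A (u n) = (a - x) + ((x - u n) + γ n • f n) := by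
      have h3 : resolvent (γ n) A (u n) = u n - γ n • f n :=
        eq_sub_of_add_eq (resolvent_add_smul_yosida (A := A) (hγ n) (u n))
      rw [h3]
      abel
    rw [h2, inner_add_right] at h1
    have h4 : inner ℝ (v - f n) ((x - u n) + γ n • f n) ≤ η n := by
      have hs := Real.sq_sqrt (hγ n).le
      have hs0 := Real.sqrt_nonneg (γ n)
      have hf0 := norm_nonneg (f n)
      have hu0 := norm_nonneg (u n - x)
      have hcs : √(γ n) ≤ c n := le_add_of_nonneg_left hu0
      have hcu : ‖u n - x‖ ≤ c n := le_add_of_nonneg_right hs0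
      have h5 : ‖(x - u n) + γ n • f n‖ ≤ ‖u n - x‖ + √(γ n) * (√(γ n) * ‖f n‖) := by
        refine (norm_add_le _ _).trans_eq ?_
        rw [norm_sub_rev, norm_smul, Real.norm_of_nonneg (hγ n).le, ← mul_assoc, ← sq, hs]
      have h7 : √(γ n) * ‖f n‖ ≤ c n * ‖f n‖ := mul_le_mul_of_nonneg_right hcs hf0
      have h8 : 0 ≤ √(γ n) * ‖f n‖ := mul_nonneg hs0 hf0
      calc inner ℝ (v - f n) ((x - u n) + γ n • f n)
          ≤ ‖v - f n‖ * ‖(x - u n) + γ n • f n‖ := real_inner_le_norm _ _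
        _ ≤ (‖v‖ + ‖f n‖) * (‖u n - x‖ + √(γ n) * (√(γ n) * ‖f n‖)) :=
          mul_le_mul (norm_sub_le _ _) h5 (norm_nonneg _) (by positivity)
        _ = ‖v‖ * (‖u n - x‖ + √(γ n) * (√(γ n) * ‖f n‖))
            + (‖u n - x‖ * ‖f n‖ + (√(γ n) * ‖f n‖) ^ 2) := by ring
        _ ≤ η n := by
          refine add_le_add (mul_le_mul_of_nonneg_left (add_le_add hcu
            (mul_le_mul_of_nonneg_left h7 hs0)) (norm_nonneg v))
            (add_le_add (mul_le_mul_of_nonneg_right hcu hf0) (pow_le_pow_left₀ h8 h7 2))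
    linarith
  refine le_of_forall_pos_le_add fun δ hδ => ?_
  obtain ⟨K, hK⟩ := eventually_atTop.1 (hη.eventually_lt_const hδ)
  have hlim : Tendsto (fun k => inner ℝ (v - Finsupp.linearCombination ℝ f (w k)) (a - x)) atTop
      (𝓝 (inner ℝ (v - g) (a - x))) := (tendsto_const_nhds.sub hg).inner tendsto_const_nhds
  -- The inequality is affine in `f n`, hence survives averaging.
  have hev : ∀ᶠ k in atTop, -δ ≤ inner ℝ (v - Finsupp.linearCombination ℝ f (w k)) (a - x) := by
    filter_upwards [hκ.eventually_ge_atTop K] with k hk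
    have h1 : v - Finsupp.linearCombination ℝ f (w k)
        = ∑ n ∈ (w k).support, w k n • (v - f n) := by
      simp only [smul_sub, Finset.sum_sub_distrib]
      rw [← Finset.sum_smul, (hw k).sum_eq_one, one_smul, Finsupp.linearCombination_apply,
        Finsupp.sum]
    rw [h1, sum_inner]
    calc -δ = ∑ n ∈ (w k).support, w k n * -δ := by
          rw [← Finset.sum_mul, (hw k).sum_eq_one, one_mul]
      _ ≤ _ := Finset.sum_le_sum fun n hn => by
          rw [real_inner_smul_left]
          refine mul_le_mul_of_nonneg_left ?_ ((hw k).nonneg n)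
          linarith [hinner n, hK n (hk.trans ((hw k).le_of_mem n hn))]
  linarith [ge_of_tendsto hlim hev]

end Limit

/-! ### The mean operator and its regularisation. -/

section Mean

open Filter Topology

variable {Ξ : Type*} [MeasurableSpace Ξ] {A : Ξ → E → Set E}

lemma inner_integral_sub_integral_nonneg [CompleteSpace E] {μ : Measure Ξ} {f g : Ξ → E}
    (hf : Integrable f μ) (hg : Integrable g μ) {c : E}
    (h : ∀ᵐ ξ ∂μ, 0 ≤ inner ℝ (f ξ - g ξ) c) : 0 ≤ inner ℝ (∫ ξ, f ξ ∂μ - ∫ ξ, g ξ ∂μ) c := by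
  rw [← integral_sub' hf hg, real_inner_comm, ← integral_inner (hf.sub hg)]
  refine integral_nonneg_of_ae ?_
  filter_upwards [h] with ξ hξ
  rw [real_inner_comm]
  exact hξ

lemma isMonotoneGraph_meanOperator [CompleteSpace E] (μ : Measure Ξ)
    (hA : ∀ ξ, IsMaximalMonotone (A ξ)) : IsMonotoneGraph (graph (meanOperator μ A)) := by
  rintro ⟨x, _⟩ ⟨φ, hφ, hφA, rfl⟩ ⟨y, _⟩ ⟨ψ, hψ, hψA, rfl⟩
  refine inner_integral_sub_integral_nonneg hφ hψ ?_
  filter_upwards [hφA, hψA] with ξ h1 h2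
  exact (hA ξ).inner_nonneg h1 h2

variable [ProperSpace E] {γ : ℝ}

/-- Since the resolvent is unique, it lies in `S` exactly when the graph meets a Borel set. -/
lemma measurable_resolvent [MeasurableSpace E] [BorelSpace E]
    (hA : ∀ ξ, IsMaximalMonotone (A ξ)) (hmeas : IsMeasurableOperator A)
    (hγ : 0 < γ) (x : E) : Measurable fun ξ => resolvent γ (A ξ) x := by
  intro S hS
  have hH : MeasurableSet ({p | p.1 ∈ S ∧ p.1 + γ • p.2 = x} : Set (E × E)) :=
    (measurable_fst hS).inter
      (measurableSet_eq_fun (measurable_fst.add (measurable_snd.const_smul γ)) measurable_const)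
  convert hmeas _ hH using 1
  ext ξ
  constructor
  · intro h
    exact ⟨(resolvent γ (A ξ) x, yosida γ (A ξ) x), (hA ξ).yosida_mem hγ x, h,
      resolvent_add_smul_yosida hγ x⟩
  · rintro ⟨⟨y, v⟩, hv, hy, hyx⟩
    have : y = resolvent γ (A ξ) x := (hA ξ).eq_resolvent hγ ⟨v, hv, hyx⟩
    rw [Set.mem_preimage, ← this]
    exact hy

lemma measurable_yosida [MeasurableSpace E] [BorelSpace E]
    (hA : ∀ ξ, IsMaximalMonotone (A ξ)) (hmeas : IsMeasurableOperator A)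
    (hγ : 0 < γ) (x : E) : Measurable fun ξ => yosida γ (A ξ) x :=
  (measurable_const.sub (measurable_resolvent hA hmeas hγ x)).const_smul γ⁻¹

lemma integrable_yosida [MeasurableSpace E] [BorelSpace E]
    (hA : ∀ ξ, IsMaximalMonotone (A ξ)) (hmeas : IsMeasurableOperator A)
    {μ : Measure Ξ} [IsFiniteMeasure μ] {z : E} {M : Ξ → ℝ} (hM : Integrable M μ) (hγ : 0 < γ)
    (hz : ∀ᵐ ξ ∂μ, ‖yosida γ (A ξ) z‖ ≤ M ξ) (x : E) :
    Integrable (fun ξ => yosida γ (A ξ) x) μ := by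
  refine ((integrable_const (γ⁻¹ * ‖x - z‖)).add hM).mono'
    (measurable_yosida hA hmeas hγ x).aestronglyMeasurable ?_
  filter_upwards [hz] with ξ hξ
  have h1 := (hA ξ).norm_yosida_sub_le hγ x z
  have h2 := norm_le_norm_add_norm_sub' (yosida γ (A ξ) x) (yosida γ (A ξ) z)
  simp only [Pi.add_apply]
  linarith

lemma exists_add_integral_yosida_eq (hA : ∀ ξ, IsMaximalMonotone (A ξ)) {μ : Measure Ξ}
    [IsProbabilityMeasure μ] (hγ : 0 < γ)
    (hint : ∀ x, Integrable (fun ξ => yosida γ (A ξ) x) μ) (y : E) :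
    ∃ x, x + ∫ ξ, yosida γ (A ξ) x ∂μ = y := by
  let F : E → E := fun x => ∫ ξ, yosida γ (A ξ) x ∂μ
  have hlip : LipschitzWith (Real.toNNReal γ⁻¹) F := by
    refine LipschitzWith.of_dist_le_mul fun a b => ?_
    rw [dist_eq_norm, dist_eq_norm, Real.coe_toNNReal _ (inv_nonneg.2 hγ.le),
      ← integral_sub (hint a) (hint b)]
    refine (norm_integral_le_of_norm_le_const
      (Eventually.of_forall fun ξ => (hA ξ).norm_yosida_sub_le hγ a b)).trans_eq ?_
    simp
  have hmono : ∀ a b, 0 ≤ inner ℝ (F a - F b) (a - b) := by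
    intro a b
    exact inner_integral_sub_integral_nonneg (hint a) (hint b)
      (Eventually.of_forall fun ξ => (hA ξ).inner_yosida_nonneg hγ a b)
  obtain ⟨x, v, rfl, hx⟩ :=
    (isMaximalMonotone_singleton hlip.continuous hmono).resolventSet_nonempty one_pos y
  exact ⟨x, by simpa using hx⟩

/-- A dense sequence and the continuity of the Yosida map make the null set independent of the
point. -/
lemma ae_forall_norm_yosida_le (hA : ∀ ξ, IsMaximalMonotone (A ξ)) {μ : Measure Ξ} (hγ : 0 < γ)
    {s : Set E} (hs : s.Nonempty) {M : Ξ → ℝ} (hdom : s ⊆ essDom μ A)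
    (hbound : ∀ x ∈ s, ∀ᵐ ξ ∂μ, ‖leastNorm (A ξ) x‖ ≤ M ξ) :
    ∀ᵐ ξ ∂μ, ∀ z ∈ s, ‖yosida γ (A ξ) z‖ ≤ M ξ := by
  have : Nonempty s := hs.to_subtype
  have h1 : ∀ᵐ ξ ∂μ, ∀ k : ℕ, ‖yosida γ (A ξ) (TopologicalSpace.denseSeq s k)‖ ≤ M ξ := by
    rw [ae_all_iff]
    intro k
    have hk := (TopologicalSpace.denseSeq s k).2
    filter_upwards [hdom hk, hbound _ hk] with ξ h2 h3
    exact ((hA ξ).norm_yosida_le_leastNorm hγ h2).trans h3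
  filter_upwards [h1] with ξ hξ z hz
  have hlip : LipschitzWith (Real.toNNReal γ⁻¹) (yosida γ (A ξ)) := by
    refine LipschitzWith.of_dist_le_mul fun a b => ?_
    rw [dist_eq_norm, dist_eq_norm, Real.coe_toNNReal _ (inv_nonneg.2 hγ.le)]
    exact (hA ξ).norm_yosida_sub_le hγ a b
  refine (TopologicalSpace.denseRange_denseSeq s).induction_on
    (p := fun z : s => ‖yosida γ (A ξ) z‖ ≤ M ξ) ⟨z, hz⟩ ?_ hξ
  exact isClosed_le (hlip.continuous.comp continuous_subtype_val).norm continuous_const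

lemma IsMaximalMonotone.mul_norm_yosida_le {A : E → Set E} (hA : IsMaximalMonotone A)
    (hγ : 0 < γ) {z₀ : E} {ρ m : ℝ} (hρ : 0 < ρ)
    (hm : ∀ z ∈ Metric.closedBall z₀ ρ, ‖yosida γ A z‖ ≤ m) (x : E) :
    ρ * ‖yosida γ A x‖ ≤ inner ℝ (x - z₀) (yosida γ A x) + m * (‖x - z₀‖ + ρ) := by
  set f := yosida γ A x with hf
  -- Testing at `z₀ + e`, with `e` of length `ρ` along `f`, produces the term `ρ‖f‖`; if `f = 0`,
  -- then `e = 0`.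
  set e : E := (ρ * ‖f‖⁻¹) • f with he
  have hnorm : ‖e‖ ≤ ρ := by
    rw [he, norm_smul, Real.norm_of_nonneg (by positivity), mul_assoc]
    exact mul_le_of_le_one_right hρ.le inv_mul_le_one
  have hinner : inner ℝ f e = ρ * ‖f‖ := by
    rw [he, real_inner_smul_right, real_inner_self_eq_norm_sq]
    rcases eq_or_ne ‖f‖ 0 with h | h
    · simp [h]
    · field_simp
  have hz : z₀ + e ∈ Metric.closedBall z₀ ρ := by simpa [mem_closedBall_iff_norm] using hnorm
  have h1 := hA.inner_yosida_nonneg hγ x (z₀ + e)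
  rw [← hf, inner_sub_left, ← sub_sub, inner_sub_right f, hinner] at h1
  have h2 := neg_le_of_abs_le (abs_real_inner_le_norm (yosida γ A (z₀ + e)) (x - z₀ - e))
  have h3 : ‖yosida γ A (z₀ + e)‖ * ‖x - z₀ - e‖ ≤ m * (‖x - z₀‖ + ρ) :=
    mul_le_mul (hm _ hz) ((norm_sub_le _ _).trans (by linarith)) (norm_nonneg _)
      ((norm_nonneg _).trans (hm _ hz))
  rw [real_inner_comm]
  linarith

/-- If `uₙ → x` and `γₙ → 0`, where `uₙ` solves the regularised equation of parameter `γₙ`, and if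
the Yosida approximations at `uₙ` are bounded in `L^{1+ε}`, then `x` solves the limit equation. -/
lemma mem_meanOperator_of_tendsto (hA : ∀ ξ, IsMaximalMonotone (A ξ)) {μ : Measure Ξ}
    [IsProbabilityMeasure μ] {γ : ℕ → ℝ} (hγ : ∀ n, 0 < γ n) (hγ0 : Tendsto γ atTop (𝓝 0))
    {u : ℕ → E} {x y : E} (hu : Tendsto u atTop (𝓝 x))
    (hint : ∀ n, Integrable (fun ξ => yosida (γ n) (A ξ) (u n)) μ)
    (heq : ∀ n, u n + ∫ ξ, yosida (γ n) (A ξ) (u n) ∂μ = y)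
    {C : ℝ} (hC : ∀ n, ∫ ξ, ‖yosida (γ n) (A ξ) (u n)‖ ∂μ ≤ C)
    {ε : ℝ} (hε : 0 < ε) {S : ℝ≥0∞} (hS : S ≠ ∞)
    (hmom : ∀ n, ∫⁻ ξ, ‖yosida (γ n) (A ξ) (u n)‖ₑ ^ (1 + ε) ∂μ ≤ S) :
    y - x ∈ meanOperator μ A x := by
  let c : ℕ → ℝ := fun n => ‖u n - x‖ + √(γ n)
  have hc0 : ∀ n, 0 ≤ c n := fun n => by positivity
  have hc : Tendsto c atTop (𝓝 0) := by
    have := (tendsto_iff_norm_sub_tendsto_zero.1 hu).add hγ0.sqrt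
    simpa using this
  -- The `L¹` bound and `c n → 0` give convergence to `0` in `L¹`, hence almost everywhere along a
  -- subsequence.
  obtain ⟨ψ, hψ, hψae⟩ : ∃ ψ : ℕ → ℕ, StrictMono ψ ∧ ∀ᵐ ξ ∂μ,
      Tendsto (fun n => c (ψ n) * ‖yosida (γ (ψ n)) (A ξ) (u (ψ n))‖) atTop (𝓝 0) := by
    refine TendstoInMeasure.exists_seq_tendsto_ae
      (f := fun n ξ => c n * ‖yosida (γ n) (A ξ) (u n)‖) (g := fun _ => 0) ?_
    refine tendstoInMeasure_of_tendsto_eLpNorm one_ne_zero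
      (fun n => ((hint n).norm.const_mul (c n)).aestronglyMeasurable)
      aestronglyMeasurable_const ?_
    have hlim : Tendsto (fun n => ENNReal.ofReal (c n * C)) atTop (𝓝 0) := by
      have := ENNReal.tendsto_ofReal (hc.mul_const C)
      simpa using this
    refine tendsto_of_tendsto_of_tendsto_of_le_of_le tendsto_const_nhds hlim
      (fun n => zero_le) fun n => ?_
    have h1 : (fun ξ => c n * ‖yosida (γ n) (A ξ) (u n)‖) - (fun _ => (0 : ℝ))
        = fun ξ => c n * ‖yosida (γ n) (A ξ) (u n)‖ := by
      ext
      simp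
    simp only [h1]
    rw [eLpNorm_one_eq_lintegral_enorm,
      ← ofReal_integral_norm_eq_lintegral_enorm ((hint n).norm.const_mul (c n))]
    refine ENNReal.ofReal_le_ofReal ?_
    simp only [norm_mul, norm_norm, Real.norm_of_nonneg (hc0 n)]
    rw [integral_const_mul]
    exact mul_le_mul_of_nonneg_left (hC n) (hc0 n)
  let f : ℕ → Ξ → E := fun n ξ => yosida (γ (ψ n)) (A ξ) (u (ψ n))
  let F : ℕ → Lp E 1 μ := fun n => (memLp_one_iff_integrable.2 (hint (ψ n))).toLp
  have hFf : ∀ n, F n =ᵐ[μ] f n := fun n => MemLp.coeFn_toLp _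
  obtain ⟨w, hw, G, hG⟩ := exists_isTailWeight_tendsto_Lp μ hε F hS fun n => by
    rw [lintegral_congr_ae (g := fun ξ => ‖f n ξ‖ₑ ^ (1 + ε))
      ((hFf n).mono fun ξ hξ => by simp only [hξ])]
    exact hmom (ψ n)
  obtain ⟨θ, hθ, hθae⟩ := (tendstoInMeasure_of_tendsto_Lp hG).exists_seq_tendsto_ae
  have hcoe : ∀ᵐ ξ ∂μ, ∀ k, (Finsupp.linearCombination ℝ F (w k) : Lp E 1 μ) ξ
      = Finsupp.linearCombination ℝ (fun n => f n ξ) (w k) := by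
    rw [ae_all_iff]
    intro k
    rw [Finsupp.linearCombination_apply, Finsupp.sum]
    have h2 : ∀ᵐ ξ ∂μ, ∀ n, (w k n • F n : Lp E 1 μ) ξ = w k n • f n ξ := by
      rw [ae_all_iff]
      intro n
      filter_upwards [Lp.coeFn_smul (w k n) (F n), hFf n] with ξ h3 h4
      rw [h3, Pi.smul_apply, h4]
    filter_upwards [Lp.coeFn_finsetSum (w k).support fun n => w k n • F n, h2] with ξ h5 h6
    rw [h5, Finsupp.linearCombination_apply, Finsupp.sum, Finset.sum_apply]
    exact Finset.sum_congr rfl fun n _ => h6 n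
  refine ⟨G, memLp_one_iff_integrable.1 (Lp.memLp G), ?_, ?_⟩
  · filter_upwards [hψae, hθae, hcoe] with ξ h1 h2 h3
    simp only [h3] at h2
    exact (hA ξ).mem_of_tendsto_linearCombination_yosida (fun n => hγ (ψ n))
      (hγ0.comp hψ.tendsto_atTop) (hu.comp hψ.tendsto_atTop) h1 hθ.tendsto_atTop
      (fun k => hw (θ k)) h2
  · have h1 : Tendsto (fun k => L1.integralCLM (Finsupp.linearCombination ℝ F (w k))) atTop
        (𝓝 (∫ ξ, G ξ ∂μ)) := by
      rw [← L1.integral_eq_integral, L1.integral_eq]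
      exact (L1.integralCLM.continuous.tendsto G).comp hG
    have h2 : ∀ n, L1.integralCLM (F n) = y - u (ψ n) := by
      intro n
      rw [← L1.integral_eq, L1.integral_eq_integral, integral_congr_ae (hFf n)]
      exact eq_sub_of_add_eq' (heq (ψ n))
    have h3 : ∀ k, L1.integralCLM (Finsupp.linearCombination ℝ F (w k))
        = Finsupp.linearCombination ℝ (fun n => y - u (ψ n)) (w k) := by
      intro k
      rw [Finsupp.linearCombination_apply, Finsupp.linearCombination_apply, map_finsuppSum]
      simp [h2]
    simp only [h3] at h1
    exact tendsto_nhds_unique h1 (tendsto_linearCombination_of_tendsto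
      (tendsto_const_nhds.sub (hu.comp hψ.tendsto_atTop)) hw)

/-- The mean of a measurable family of maximal monotone operators is maximal monotone, when the
least-norm selections are dominated on a ball and locally bounded in `L^{1+ε}`, and the domains
satisfy a linear regularity condition. -/
theorem isMaximalMonotone_meanOperator [MeasurableSpace E] [BorelSpace E] {μ : Measure Ξ}
    [IsProbabilityMeasure μ] (hA : ∀ ξ, IsMaximalMonotone (A ξ)) (hmeas : IsMeasurableOperator A)
    {z₀ : E} {ρ : ℝ} {M : Ξ → ℝ} (hρ : 0 < ρ) (hdom : Metric.closedBall z₀ ρ ⊆ essDom μ A)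
    (hM : Integrable M μ)
    (hbound : ∀ x ∈ Metric.closedBall z₀ ρ, ∀ᵐ ξ ∂μ, ‖leastNorm (A ξ) x‖ ≤ M ξ)
    (hmom : ∀ K : Set E, IsCompact K → ∃ ε : ℝ, 0 < ε ∧
      (⨆ x ∈ K ∩ essDom μ A, ∫⁻ ξ, ‖leastNorm (A ξ) x‖ₑ ^ (1 + ε) ∂μ) < ∞)
    {C : ℝ} (hC : 0 < C) (hdist : ∀ x : E, C * Metric.infDist x (essDom μ A) ≤
      ∫ ξ, Metric.infDist x (dom (A ξ)) ∂μ) :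
    IsMaximalMonotone (meanOperator μ A) := by
  refine isMaximalMonotone_of_surjective (isMonotoneGraph_meanOperator μ hA) fun y => ?_
  have hz₀ : z₀ ∈ Metric.closedBall z₀ ρ := Metric.mem_closedBall_self hρ.le
  let γ : ℕ → ℝ := fun n => 1 / ((n : ℝ) + 1)
  have hγ : ∀ n, 0 < γ n := fun n => by positivity
  have hγ1 : ∀ n, γ n ≤ 1 := fun n => by
    refine div_le_one_of_le₀ ?_ (by positivity)
    linarith [(Nat.cast_nonneg n : (0 : ℝ) ≤ n)]
  have hγ0 : Tendsto γ atTop (𝓝 0) := tendsto_one_div_add_atTop_nhds_zero_nat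
  have hball : ∀ n, ∀ᵐ ξ ∂μ, ∀ z ∈ Metric.closedBall z₀ ρ, ‖yosida (γ n) (A ξ) z‖ ≤ M ξ :=
    fun n => ae_forall_norm_yosida_le hA (hγ n) ⟨z₀, hz₀⟩ hdom hbound
  have hint : ∀ n x, Integrable (fun ξ => yosida (γ n) (A ξ) x) μ := fun n x =>
    integrable_yosida hA hmeas hM (hγ n) ((hball n).mono fun ξ h => h z₀ hz₀) x
  choose u hu using fun n => exists_add_integral_yosida_eq hA (hγ n) (hint n) y
  have hint_eq : ∀ n, ∫ ξ, yosida (γ n) (A ξ) (u n) ∂μ = y - u n := fun n =>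
    eq_sub_of_add_eq' (hu n)
  set I := ∫ ξ, M ξ ∂μ with hI
  have hz₀I : ∀ n, ‖∫ ξ, yosida (γ n) (A ξ) z₀ ∂μ‖ ≤ I := fun n =>
    norm_integral_le_of_norm_le hM ((hball n).mono fun ξ h => h z₀ hz₀)
  have hI0 : 0 ≤ I := (norm_nonneg _).trans (hz₀I 0)
  set R := ‖y - z₀‖ + I with hR
  have huR : ∀ n, ‖u n - z₀‖ ≤ R := by
    intro n
    have h1 := inner_integral_sub_integral_nonneg (hint n (u n)) (hint n z₀)
      (Eventually.of_forall fun ξ => (hA ξ).inner_yosida_nonneg (hγ n) (u n) z₀)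
    set b := ∫ ξ, yosida (γ n) (A ξ) z₀ ∂μ with hb
    have h2 : y - u n - b = (y - z₀ - b) - (u n - z₀) := by abel
    rw [hint_eq, h2, inner_sub_left, real_inner_self_eq_norm_sq] at h1
    have h3 := real_inner_le_norm (y - z₀ - b) (u n - z₀)
    have h4 : ‖y - z₀ - b‖ ≤ R := (norm_sub_le _ _).trans (by linarith [hz₀I n])
    by_contra! hlt
    have h5 : 0 < ‖u n - z₀‖ := ((norm_nonneg _).trans h4).trans_lt hlt
    nlinarith
  have hR0 : 0 ≤ R := (norm_nonneg _).trans (huR 0)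
  -- `L` comes from integrating `IsMaximalMonotone.mul_norm_yosida_le` at `u n`.
  set L := (R * (‖y - z₀‖ + R) + I * (R + ρ)) / ρ with hL
  have hL0 : 0 ≤ L := by positivity
  have hnorm : ∀ n, ∫ ξ, ‖yosida (γ n) (A ξ) (u n)‖ ∂μ ≤ L := by
    intro n
    have h1 : ∫ ξ, ρ * ‖yosida (γ n) (A ξ) (u n)‖ ∂μ ≤
        ∫ ξ, (inner ℝ (u n - z₀) (yosida (γ n) (A ξ) (u n)) + M ξ * (‖u n - z₀‖ + ρ)) ∂μ := by
      refine integral_mono_ae ((hint n _).norm.const_mul ρ)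
        (((hint n _).const_inner _).add (hM.mul_const _)) ?_
      filter_upwards [hball n] with ξ hξ
      exact (hA ξ).mul_norm_yosida_le (hγ n) hρ hξ (u n)
    rw [integral_const_mul, integral_add ((hint n _).const_inner _) (hM.mul_const _),
      integral_inner (hint n _), integral_mul_const, hint_eq, ← hI] at h1
    have h2 : inner ℝ (u n - z₀) (y - u n) ≤ R * (‖y - z₀‖ + R) := by
      refine (real_inner_le_norm _ _).trans (mul_le_mul (huR n) ?_ (norm_nonneg _) hR0)
      have : y - u n = (y - z₀) - (u n - z₀) := by abel
      rw [this]
      exact (norm_sub_le _ _).trans (by linarith [huR n])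
    have h3 : I * (‖u n - z₀‖ + ρ) ≤ I * (R + ρ) :=
      mul_le_mul_of_nonneg_left (by linarith [huR n]) hI0
    rw [hL, le_div_iff₀ hρ]
    linarith
  -- The `+ 1` gives a strict inequality: the distance to the essential domain need not be attained.
  set b := L / C + 1 with hb
  have hb0 : 0 ≤ b := by positivity
  have hclose : ∀ n, ∃ v ∈ essDom μ A, dist (u n) v < γ n * b := by
    intro n
    rw [← Metric.infDist_lt_iff ⟨z₀, hdom hz₀⟩]
    have h1 : ∫ ξ, Metric.infDist (u n) (dom (A ξ)) ∂μ ≤ γ n * L := by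
      refine (integral_mono_of_nonneg (Eventually.of_forall fun ξ => Metric.infDist_nonneg)
        ((hint n (u n)).norm.const_mul (γ n))
        (Eventually.of_forall fun ξ => (hA ξ).infDist_dom_le (hγ n) (u n))).trans ?_
      rw [integral_const_mul]
      exact mul_le_mul_of_nonneg_left (hnorm n) (hγ n).le
    have h2 : Metric.infDist (u n) (essDom μ A) ≤ γ n * (L / C) := by
      rw [← mul_div_assoc, le_div_iff₀ hC, mul_comm]
      exact (hdist (u n)).trans h1
    rw [hb, mul_add, mul_one]
    linarith [hγ n]
  choose v hvdom hv using hclose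
  -- This ball contains every `v n`, so one exponent serves all `n`.
  obtain ⟨ε, hε, hsup⟩ := hmom _ (isCompact_closedBall z₀ (R + b))
  set S := ⨆ x ∈ Metric.closedBall z₀ (R + b) ∩ essDom μ A,
    ∫⁻ ξ, ‖leastNorm (A ξ) x‖ₑ ^ (1 + ε) ∂μ with hSdef
  have hvK : ∀ n, v n ∈ Metric.closedBall z₀ (R + b) ∩ essDom μ A := by
    refine fun n => ⟨?_, hvdom n⟩
    have h1 := dist_triangle_left (v n) z₀ (u n)
    have h2 := huR n
    rw [← dist_eq_norm] at h2
    have h3 : γ n * b ≤ b := mul_le_of_le_one_left hb0 (hγ1 n)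
    rw [Metric.mem_closedBall]
    linarith [hv n]
  have hmoment : ∀ n, ∫⁻ ξ, ‖yosida (γ n) (A ξ) (u n)‖ₑ ^ (1 + ε) ∂μ ≤
      2 ^ ε * (S + ENNReal.ofReal b ^ (1 + ε)) := by
    intro n
    have h1 : ∀ᵐ ξ ∂μ, ‖yosida (γ n) (A ξ) (u n)‖ₑ ^ (1 + ε) ≤
        2 ^ ε * (‖leastNorm (A ξ) (v n)‖ₑ ^ (1 + ε) + ENNReal.ofReal b ^ (1 + ε)) := by
      filter_upwards [hvdom n] with ξ hξ
      have h2 : ‖yosida (γ n) (A ξ) (u n)‖ ≤ ‖leastNorm (A ξ) (v n)‖ + b := by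
        have h3 := (hA ξ).norm_yosida_le_leastNorm (hγ n) hξ
        have h4 := (hA ξ).norm_yosida_sub_le (hγ n) (u n) (v n)
        have h5 := norm_le_norm_add_norm_sub' (yosida (γ n) (A ξ) (u n))
          (yosida (γ n) (A ξ) (v n))
        have h6 : (γ n)⁻¹ * ‖u n - v n‖ ≤ b := by
          rw [inv_mul_le_iff₀ (hγ n), ← dist_eq_norm]
          exact (hv n).le
        linarith
      have h7 : ‖yosida (γ n) (A ξ) (u n)‖ₑ ≤
          ‖leastNorm (A ξ) (v n)‖ₑ + ENNReal.ofReal b := by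
        rw [← ofReal_norm, ← ofReal_norm, ← ENNReal.ofReal_add (norm_nonneg _) hb0]
        exact ENNReal.ofReal_le_ofReal h2
      refine (ENNReal.rpow_le_rpow h7 (by positivity)).trans ?_
      have := ENNReal.rpow_add_le_mul_rpow_add_rpow ‖leastNorm (A ξ) (v n)‖ₑ (ENNReal.ofReal b)
        (p := 1 + ε) (by linarith)
      rwa [add_sub_cancel_left] at this
    refine (lintegral_mono_ae h1).trans ?_
    rw [lintegral_const_mul' _ _ (ENNReal.rpow_ne_top_of_nonneg hε.le (by simp)),
      lintegral_add_right _ measurable_const, lintegral_const, measure_univ, mul_one]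
    gcongr
    exact le_iSup₂_of_le (v n) (hvK n) le_rfl
  have hS' : 2 ^ ε * (S + ENNReal.ofReal b ^ (1 + ε)) ≠ ∞ :=
    ENNReal.mul_ne_top (ENNReal.rpow_ne_top_of_nonneg hε.le (by simp))
      (ENNReal.add_ne_top.2 ⟨hsup.ne, ENNReal.rpow_ne_top_of_nonneg (by positivity) (by simp)⟩)
  obtain ⟨x, -, φ, hφ, hφx⟩ := (isCompact_closedBall z₀ R).tendsto_subseq (x := u)
    fun n => mem_closedBall_iff_norm.2 (huR n)
  refine ⟨x, y - x, ?_, by abel⟩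
  exact mem_meanOperator_of_tendsto hA (fun n => hγ (φ n)) (hγ0.comp hφ.tendsto_atTop) hφx
    (fun n => hint (φ n) _) (fun n => hu (φ n)) (fun n => hnorm (φ n)) hε hS'
    (fun n => hmoment (φ n))

end Mean

end RandMon

end

theorem proposition1 {N : ℕ} {Ξ : Type*} [MeasurableSpace Ξ] (μ : Measure Ξ)
    [IsProbabilityMeasure μ] [μ.IsComplete]
    (A : Ξ → EuclideanSpace ℝ (Fin N) → Set (EuclideanSpace ℝ (Fin N)))
    (hA : ∀ ξ, RandMon.IsMaximalMonotone (A ξ))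
    (hmeas : RandMon.IsMeasurableOperator A)
    (hball : ∃ (z₀ : EuclideanSpace ℝ (Fin N)) (ρ : ℝ) (M : Ξ → ℝ),
      0 < ρ ∧ Metric.closedBall z₀ ρ ⊆ RandMon.essDom μ A ∧ Integrable M μ ∧
      ∀ x ∈ Metric.closedBall z₀ ρ, ∀ᵐ ξ ∂μ, ‖RandMon.leastNorm (A ξ) x‖ ≤ M ξ)
    (hmom : ∀ K : Set (EuclideanSpace ℝ (Fin N)), IsCompact K → ∃ ε : ℝ, 0 < ε ∧
      (⨆ x ∈ K ∩ RandMon.essDom μ A,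
        ∫⁻ ξ, ‖RandMon.leastNorm (A ξ) x‖ₑ ^ (1 + ε) ∂μ) < ∞ ∧
      ∃ y₀ ∈ RandMon.essDom μ A,
        ∫⁻ ξ, ‖RandMon.leastNorm (A ξ) y₀‖ₑ ^ (1 + 1 / ε) ∂μ < ∞)
    (hdist : ∃ C : ℝ, 0 < C ∧ ∀ x : EuclideanSpace ℝ (Fin N),
      C * Metric.infDist x (RandMon.essDom μ A) ≤
        ∫ ξ, Metric.infDist x (RandMon.dom (A ξ)) ∂μ)
    (hJ : ∃ C : EuclideanSpace ℝ (Fin N) → ℝ,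
      (∀ K : Set (EuclideanSpace ℝ (Fin N)), IsCompact K → Bornology.IsBounded (C '' K)) ∧
      ∀ (x : EuclideanSpace ℝ (Fin N)) (γ : ℝ), 0 < γ →
        ∫⁻ ξ, ‖RandMon.resolvent γ (A ξ) x -
            RandMon.proj (closure (RandMon.dom (A ξ))) x‖ₑ ∂μ ≤ ENNReal.ofReal (γ * C x)) :
    RandMon.IsMaximalMonotone (RandMon.meanOperator μ A) := by
  obtain ⟨z₀, ρ, M, hρ, hdom, hM, hbound⟩ := hball
  obtain ⟨C, hC, hd⟩ := hdist
  refine RandMon.isMaximalMonotone_meanOperator hA hmeas hρ hdom hM hbound (fun K hK => ?_) hC hd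
  obtain ⟨ε, hε, hsup, -⟩ := hmom K hK
  exact ⟨ε, hε, hsup⟩
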